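/- **Theorem 3.1.** Let $\mathscr V$ be a Polish space, $\nu$ a $\sigma$-finite Borel measure on $\mathscr V$, and $N$ a Poisson random measure on $\mathscr V$ with intensity $\nu$. Let $f_1,\dots,f_n:\mathscr V\to[0,\infty)$ be measurable and put $\tau_i=N(f_i)=\int f_i\,dN$. For measurable $g:\mathscr V\to[0,\infty]$ put $\Lambda(g)=\int_{\mathscr V}(1-e^{-g(v)})\,\nu(dv)$, and for $\mathbf w=(w_1,\dots,w_n)$ with $w_i\ge 0$ put $\Omega_n(v)=\sum_{i=1}^n w_if_i(v)$ and $\nu_{\Omega_n}(dv)=e^{-\Omega_n(v)}\,\nu(dv)$. Assume $\Lambda(\Omega_n)<\infty$ for all $w_1,\dots,w_n\ge 0$. Write $\phi(\cdot\,|\,m,s)$ for the normal density with mean $m$ and variance $s$, and let $X_1,\dots,X_n,\mu,\beta,\Delta\in\mathbb R$. Let $$\mathscr L(\mathbf X|\mu,\beta)=\int_{(0,\infty)^n}\Big[\prod_{i=1}^n\phi(X_i\,|\,\mu\Delta+\beta w_i^{-1},w_i^{-1})\Big]\,\mathbb E\Big[\prod_{i=1}^n e^{-w_i\tau_i}\tau_i\Big]\,d\mathbf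 w$$ be the generalized hyperbolic integrated volatility likelihood. Then, as an identity in $[0,\infty]$, $$\mathscr L(\mathbf X|\mu,\beta)=\int_{(0,\infty)^n}\mathscr B(\mathbf w)\,e^{-\Lambda(\Omega_n)}\prod_{i=1}^n\phi(X_i\,|\,\mu\Delta+\beta w_i^{-1},w_i^{-1})\,d\mathbf w,$$ where, for every $\mathbf w\in(0,\infty)^n$, $$\mathscr B(\mathbf w)=\int_{\mathscr V^n}\prod_{i=1}^n f_i(v_i)\,\mathscr M(d\mathbf v|\nu_{\Omega_n})=\sum_{\mathbf p}\prod_{j=1}^{n(\mathbf p)}\int_{\mathscr V}\Big[\prod_{i\in C_j}f_i(v)\Big]\,\nu_{\Omega_n}(dv)<\infty .$$ Here $\mathscr M(d\mathbf v|\nu_{\Omega_n})=\mathbb E[N'(dv_1)\cdots N'(dv_n)]$ is the $n$-th moment measure of a Poisson random measure $N'$ with intensity $\nu_{\Omega_n}$, and $\sum_{\mathbf p}$ is the sum over all partitions $\mathbf p=\{C_1,\dots,C_{n(\mathbf p)}\}$ of $\{1,\dots,n\}$. -/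

import Mathlib

open MeasureTheory ProbabilityTheory
open scoped ENNReal NNReal

noncomputable section

namespace IntegratedVolatility

/-- The function `x ↦ e^{-x}` on `[0, ∞]`, with `e^{-∞} = 0`. -/
def expNeg (x : ℝ≥0∞) : ℝ≥0∞ := EReal.exp (-(x : EReal))

/-- The Poisson distribution with mean `r ∈ [0, ∞]`, as a law on `[0, ∞]`; for `r = ∞` it is
the unit mass at `∞`. -/
def poissonLaw (r : ℝ≥0∞) : Measure ℝ≥0∞ :=
  if r = ∞ then Measure.dirac ∞
  else (poissonMeasure r.toNNReal).map (fun k : ℕ => (k : ℝ≥0∞))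

/-- `N`, defined on the probability space `(S, P)`, is a Poisson random measure on `V` with
intensity `ν`: it is a random measure, `N(B)` is Poisson distributed with mean `ν(B)` for every
measurable `B`, and `N(B₁), …, N(Bₖ)` are independent when `B₁, …, Bₖ` are measurable and
pairwise disjoint. -/
structure IsPoissonRandomMeasure {S V : Type*} [MeasurableSpace S] [MeasurableSpace V]
    (P : Measure S) (N : S → Measure V) (ν : Measure V) : Prop where
  measurable : Measurable N
  law : ∀ B : Set V, MeasurableSet B → P.map (fun s => N s B) = poissonLaw (ν B)
  indep : ∀ (k : ℕ) (B : Fin k → Set V), (∀ j, MeasurableSet (B j)) →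
    Pairwise (fun i j => Disjoint (B i) (B j)) → iIndepFun (fun j s => N s (B j)) P

/-- The `n`-th moment measure `E[N(dv₁) ⋯ N(dvₙ)]` of a random measure `N`: the mean of the
`n`-fold product measure `N ⊗ ⋯ ⊗ N` on `Vⁿ`. -/
def momentMeasure {S V : Type*} [MeasurableSpace S] [MeasurableSpace V]
    (n : ℕ) (P : Measure S) (N : S → Measure V) : Measure (Fin n → V) :=
  P.bind (fun s => Measure.pi (fun _ : Fin n => N s))

/-- `Λ(g) = ∫ (1 - e^{-g(v)}) ν(dv)`. -/
def laplaceExponent {V : Type*} [MeasurableSpace V] (ν : Measure V) (g : V → ℝ≥0∞) : ℝ≥0∞ :=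
  ∫⁻ v, (1 - expNeg (g v)) ∂ν

/-- `Ωₙ(v) = ∑ᵢ wᵢ fᵢ(v)` (used for `wᵢ ≥ 0`). -/
def weightedSum {V : Type*} {n : ℕ} (f : Fin n → V → ℝ≥0) (w : Fin n → ℝ) (v : V) : ℝ≥0∞ :=
  ∑ i, ENNReal.ofReal (w i) * (f i v : ℝ≥0∞)

/-- `ν_g(dv) = e^{-g(v)} ν(dv)`. -/
def tilted {V : Type*} [MeasurableSpace V] (ν : Measure V) (g : V → ℝ≥0∞) : Measure V :=
  ν.withDensity (fun v => expNeg (g v))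

/-- `τ = N(f) = ∫ f(v) N(dv)`. -/
def linearFunctional {S V : Type*} [MeasurableSpace V] (N : S → Measure V) (f : V → ℝ≥0)
    (s : S) : ℝ≥0∞ :=
  ∫⁻ v, (f v : ℝ≥0∞) ∂(N s)

/-- The positive orthant of `ℝⁿ`. -/
def posOrthant (n : ℕ) : Set (Fin n → ℝ) := {w | ∀ i, 0 < w i}

/-- `∏ᵢ φ(Xᵢ | μΔ + β wᵢ⁻¹, wᵢ⁻¹)`, where `φ(· | m, s)` is the normal density with mean `m`
and variance `s`. -/
def normalProduct {n : ℕ} (X : Fin n → ℝ) (μ β Δ : ℝ) (w : Fin n → ℝ) : ℝ≥0∞ :=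
  ∏ i, gaussianPDF (μ * Δ + β * (w i)⁻¹) (Real.toNNReal (w i)⁻¹) (X i)

/-- The likelihood
`∫ ∏ᵢ φ(Xᵢ | μΔ + β wᵢ⁻¹, wᵢ⁻¹) E[∏ᵢ e^{-wᵢ τᵢ} τᵢ] dw` over the positive orthant, for
nonnegative random variables `τ₁, …, τₙ` on the probability space `(S, P)`. -/
def likelihood {S : Type*} [MeasurableSpace S] (P : Measure S) {n : ℕ}
    (τ : Fin n → S → ℝ≥0∞) (X : Fin n → ℝ) (μ β Δ : ℝ) : ℝ≥0∞ :=
  ∫⁻ w in posOrthant n, normalProduct X μ β Δ w *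
    ∫⁻ s, ∏ i, (expNeg (ENNReal.ofReal (w i) * τ i s) * τ i s) ∂P

/-- The sum over all partitions of `{1, …, n}` of the product, over the cells `C` of the
partition, of `∫ ∏_{i ∈ C} fᵢ(v) ρ(dv)`. -/
def partitionSum {V : Type*} [MeasurableSpace V] {n : ℕ} (f : Fin n → V → ℝ≥0)
    (ρ : Measure V) : ℝ≥0∞ :=
  ∑ p : Finpartition (Finset.univ : Finset (Fin n)),
    ∏ C ∈ p.parts, ∫⁻ v, ∏ i ∈ C, (f i v : ℝ≥0∞) ∂ρ

end IntegratedVolatility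

end

/-! For a Poisson variable `K` of mean `r`, `E[K g(K)] = r E[g(K + 1)]`. For a vector of independent
Poisson variables this becomes a Mecke equation: one linear factor `∑ c_y x_y` is traded for an
extra unit mass at some site `j`, with weight `r_j c_j`. The extra mass multiplies the exponential
by `e^{-a_j}` and adds a constant to each remaining linear factor. Expanding the product of those
factors over subsets `t` selects the indices that share the new point with the first one. This is
the recursion for partition sums, `cellSum_insert`; when no factor remains, the Laplace transform
supplies `e^{-Λ}`. The result is `lintegral_expNeg_mul_prod_pi_poissonLaw`.

Integrals of simple functions are linear in the masses of disjoint fibres, so they fall under this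
case. General functions are reached by two different limits. With the exponential, dominated
convergence applies: `x e^{-wx} ≤ 1/w` controls the expectation, and `e^{-Ω} ∏_{i ∈ C} f_i ≤ const ·
(1 - e^{-Ω})` controls the cells, which are thus finite because `Λ(Ω) < ∞`. Without it, monotone
convergence in `[0, ∞]` suffices; applied to the tilted intensity, together with Tonelli, it
evaluates the moment measure as the same partition sum. The likelihood identity then holds pointwise
in `w`. -/

noncomputable section

namespace IntegratedVolatility

/-! ### The exponential on `[0, ∞]` and its bounds -/

section ExpNeg

lemma expNeg_coe (x : ℝ≥0) : expNeg x = ENNReal.ofReal (Real.exp (-x)) := by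
  rw [expNeg, show ((x : ℝ≥0∞) : EReal) = ((x : ℝ) : EReal) from rfl, ← EReal.coe_neg,
    EReal.exp_coe]

lemma expNeg_ofReal {x : ℝ} (hx : 0 ≤ x) :
    expNeg (ENNReal.ofReal x) = ENNReal.ofReal (Real.exp (-x)) := by
  rw [ENNReal.ofReal, expNeg_coe, Real.coe_toNNReal x hx]

@[simp] lemma expNeg_zero : expNeg 0 = 1 := by simp [expNeg]

@[simp] lemma expNeg_top : expNeg ∞ = 0 := by simp [expNeg]

lemma expNeg_add (x y : ℝ≥0∞) : expNeg (x + y) = expNeg x * expNeg y := by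
  induction x with
  | top => simp
  | coe x =>
    induction y with
    | top => simp
    | coe y =>
      rw [← ENNReal.coe_add, expNeg_coe, expNeg_coe, expNeg_coe,
        ← ENNReal.ofReal_mul (Real.exp_nonneg _), ← Real.exp_add]
      congr 2
      push_cast
      ring

lemma expNeg_sum {ι : Type*} (s : Finset ι) (x : ι → ℝ≥0∞) :
    expNeg (∑ i ∈ s, x i) = ∏ i ∈ s, expNeg (x i) := by
  classical
  induction s using Finset.induction_on with
  | empty => simp
  | insert a s ha ih => rw [Finset.sum_insert ha, Finset.prod_insert ha, expNeg_add, ih]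

lemma expNeg_antitone : Antitone expNeg := fun _ _ h =>
  EReal.exp_monotone (EReal.neg_le_neg_iff.2 (EReal.coe_ennreal_le_coe_ennreal_iff.2 h))

lemma expNeg_le_one (x : ℝ≥0∞) : expNeg x ≤ 1 := by
  simpa using expNeg_antitone (zero_le (a := x))

lemma expNeg_ne_top (x : ℝ≥0∞) : expNeg x ≠ ∞ :=
  ((expNeg_le_one x).trans_lt ENNReal.one_lt_top).ne

lemma continuous_expNeg : Continuous expNeg :=
  ENNReal.continuous_exp.comp (continuous_neg.comp continuous_coe_ennreal_ereal)

@[fun_prop]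
lemma measurable_expNeg : Measurable expNeg := continuous_expNeg.measurable

/-- A single term of the exponential series: `1 + xᵏ / k! ≤ eˣ` for `k ≥ 1`. -/
lemma pow_mul_expNeg_le (x : ℝ≥0∞) {k : ℕ} (hk : k ≠ 0) :
    x ^ k * expNeg x ≤ k.factorial * (1 - expNeg x) := by
  induction x with
  | top => simp
  | coe x =>
    have h1 : 1 + (x : ℝ) ^ k / k.factorial ≤ Real.exp x := by
      have h := Real.sum_le_exp_of_nonneg (x := (x : ℝ)) x.2 (k + 1)
      rw [Finset.sum_range_succ] at h
      have h0 : (1 : ℝ) ≤ ∑ i ∈ Finset.range k, (x : ℝ) ^ i / i.factorial := by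
        have := Finset.single_le_sum (f := fun i => (x : ℝ) ^ i / i.factorial)
          (fun i _ => by positivity) (Finset.mem_range.2 (Nat.pos_of_ne_zero hk))
        simpa using this
      linarith
    rw [expNeg_coe, show (x : ℝ≥0∞) ^ k = ENNReal.ofReal ((x : ℝ) ^ k) by
        rw [ENNReal.ofReal_pow x.coe_nonneg, ENNReal.ofReal_coe_nnreal],
      ← ENNReal.ofReal_mul (by positivity), ← ENNReal.ofReal_one,
      ← ENNReal.ofReal_sub _ (Real.exp_nonneg _), ← ENNReal.ofReal_natCast,
      ← ENNReal.ofReal_mul (by positivity)]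
    apply ENNReal.ofReal_le_ofReal
    have h2 : (x : ℝ) ^ k ≤ k.factorial * (Real.exp x - 1) := by
      have h3 : (x : ℝ) ^ k / k.factorial ≤ Real.exp x - 1 := by linarith
      rw [div_le_iff₀ (by positivity)] at h3
      linarith
    calc (x : ℝ) ^ k * Real.exp (-x)
        ≤ k.factorial * (Real.exp x - 1) * Real.exp (-x) := by gcongr
      _ = k.factorial * (1 - Real.exp (-x)) := by
        rw [mul_assoc, sub_mul, ← Real.exp_add]
        simp

lemma mul_expNeg_le_one (x : ℝ≥0∞) : x * expNeg x ≤ 1 := by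
  simpa using (pow_mul_expNeg_le x one_ne_zero).trans (mul_le_mul_right tsub_le_self _)

lemma expNeg_mul_mul_le {a : ℝ≥0∞} (ha : a ≠ 0) (ha' : a ≠ ∞) (x : ℝ≥0∞) :
    expNeg (a * x) * x ≤ a⁻¹ := by
  have h : a⁻¹ * (a * x * expNeg (a * x)) = expNeg (a * x) * x := by
    rw [mul_assoc, ← mul_assoc a⁻¹, ENNReal.inv_mul_cancel ha ha', one_mul, mul_comm]
  rw [← h]
  simpa using mul_le_mul_right (mul_expNeg_le_one (a * x)) a⁻¹

/-- For `a > 0` the function `x ↦ x e^{-ax}` extends continuously to `[0, ∞]`. -/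
lemma continuous_expNeg_mul_mul {a : ℝ≥0∞} (ha : a ≠ 0) (ha' : a ≠ ∞) :
    Continuous (fun x : ℝ≥0∞ => expNeg (a * x) * x) := by
  have hc : ∀ {b : ℝ≥0∞}, b ≠ ∞ → Continuous (fun x : ℝ≥0∞ => expNeg (b * x)) := fun hb =>
    continuous_expNeg.comp (ENNReal.continuous_const_mul hb)
  rw [continuous_iff_continuousAt]
  intro x
  rcases eq_or_ne x ∞ with rfl | hx
  -- At infinity the exponent is halved: one half absorbs the factor `x`, the other forces the limit
  -- `0`.
  · have hb : a / 2 ≠ 0 := by simp [ha]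
    have hb' : a / 2 ≠ ∞ := (ENNReal.div_lt_top ha' two_ne_zero).ne
    have hbound : ∀ x : ℝ≥0∞, expNeg (a * x) * x ≤ (a / 2)⁻¹ * expNeg (a / 2 * x) := by
      intro x
      calc expNeg (a * x) * x = expNeg (a / 2 * x) * x * expNeg (a / 2 * x) := by
            conv_lhs => rw [← ENNReal.add_halves a, add_mul, expNeg_add]
            ring
        _ ≤ _ := mul_le_mul_left (expNeg_mul_mul_le hb hb' x) _
    have hlim : Filter.Tendsto (fun x : ℝ≥0∞ => (a / 2)⁻¹ * expNeg (a / 2 * x))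
        (nhds ∞) (nhds 0) := by
      have h := ENNReal.Tendsto.const_mul ((hc hb').tendsto ∞)
        (Or.inr (ENNReal.inv_ne_top.2 hb))
      simpa [ENNReal.mul_top hb] using h
    have : Filter.Tendsto (fun x : ℝ≥0∞ => expNeg (a * x) * x) (nhds ∞) (nhds 0) :=
      tendsto_of_tendsto_of_tendsto_of_le_of_le tendsto_const_nhds hlim
        (fun _ => zero_le) hbound
    simpa [ContinuousAt, ENNReal.mul_top ha] using this
  · exact ENNReal.Tendsto.mul ((hc ha').tendsto x) (Or.inr hx) Filter.tendsto_id
      (Or.inr (expNeg_ne_top _))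

end ExpNeg

/-! ### Sums over set partitions -/

section CellSum

variable {α : Type*} [DecidableEq α]

/-- The sum over all partitions of the finite set `s` of the product of `I` over the cells. -/
def cellSum (s : Finset α) (I : Finset α → ℝ≥0∞) : ℝ≥0∞ :=
  ∑ p : Finpartition s, ∏ C ∈ p.parts, I C

@[simp] lemma cellSum_empty (I : Finset α → ℝ≥0∞) : cellSum ∅ I = 1 := by
  have h : (Finset.univ : Finset (Finpartition (∅ : Finset α))) = {Finpartition.empty _} := by
    ext p
    have : p = Finpartition.empty (Finset α) :=
      Subsingleton.elim (α := Finpartition (⊥ : Finset α)) _ _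
    simp [this]
  rw [cellSum, h, Finset.sum_singleton]
  simp [Finpartition.empty]

/-- Adds the cell `insert a t` to a partition of `s \ t`. -/
def addCell {a : α} {s : Finset α} (ha : a ∉ s) (t : Finset α) (ht : t ⊆ s)
    (p : Finpartition (s \ t)) : Finpartition (insert a s) :=
  p.extend (b := insert a t) (Finset.insert_nonempty a t).ne_empty
    (by
      rw [Finset.disjoint_left]
      intro x hx hx'
      rw [Finset.mem_sdiff] at hx
      rcases Finset.mem_insert.1 hx' with rfl | h
      · exact ha hx.1
      · exact hx.2 h)
    (by
      ext x
      simp only [Finset.sup_eq_union, Finset.mem_union, Finset.mem_sdiff, Finset.mem_insert]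
      have := @ht x
      tauto)

lemma insert_notMem_parts {a : α} {s t : Finset α} (ha : a ∉ s) (p : Finpartition (s \ t))
    (u : Finset α) : insert a u ∉ p.parts := fun h =>
  ha (Finset.mem_sdiff.1 (p.subset h (Finset.mem_insert_self a u))).1

/-- The cell of a partition of `insert a s` that contains `a` can be split off. -/
lemma exists_addCell {a : α} {s : Finset α} (ha : a ∉ s) (q : Finpartition (insert a s)) :
    ∃ (t : Finset α) (ht : t ⊆ s) (p : Finpartition (s \ t)), addCell ha t ht p = q := by
  obtain ⟨C, hC, haC⟩ := q.exists_mem (Finset.mem_insert_self a s)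
  have hCs : C.erase a ⊆ s := by
    rw [← Finset.subset_insert_iff]
    exact q.subset hC
  refine ⟨C.erase a, hCs, q.ofSubset (parts := q.parts.erase C) (Finset.erase_subset _ _) ?_, ?_⟩
  · ext x
    simp only [Finset.mem_sup, Finset.mem_erase, id, Finset.mem_sdiff]
    constructor
    · rintro ⟨D, ⟨hDC, hD⟩, hx⟩
      have hxC : x ∉ C := fun h => hDC (q.eq_of_mem_parts hD hC hx h)
      have hxa : x ≠ a := fun h => hxC (h ▸ haC)
      exact ⟨Finset.mem_of_mem_insert_of_ne (q.subset hD hx) hxa, fun h => hxC h.2⟩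
    · rintro ⟨hxs, hx⟩
      obtain ⟨D, hD, hxD⟩ := q.exists_mem (Finset.mem_insert_of_mem hxs : x ∈ insert a s)
      refine ⟨D, ⟨?_, hD⟩, hxD⟩
      rintro rfl
      exact hx ⟨fun h => ha (h ▸ hxs), hxD⟩
  · ext1
    simp [addCell, Finset.insert_erase haC, Finset.insert_erase hC]

/-- Recursion for `cellSum`: choose the cell that contains `a`. -/
lemma cellSum_insert {a : α} {s : Finset α} (ha : a ∉ s) (I : Finset α → ℝ≥0∞) :
    cellSum (insert a s) I = ∑ t ∈ s.powerset, I (insert a t) * cellSum (s \ t) I := by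
  simp_rw [cellSum, Finset.mul_sum]
  rw [← Finset.sum_coe_sort s.powerset, ← Fintype.sum_sigma' (α := fun t : s.powerset =>
    Finpartition (s \ t.1)) (fun t p => I (insert a t.1) * ∏ C ∈ p.parts, I C)]
  symm
  refine Finset.sum_bij (fun x _ => addCell ha x.1.1 (Finset.mem_powerset.1 x.1.2) x.2)
    (fun _ _ => Finset.mem_univ _) ?_ ?_ ?_
  · rintro ⟨⟨t, ht⟩, p⟩ _ ⟨⟨t', ht'⟩, p'⟩ _ h
    have hparts : insert (insert a t) p.parts = insert (insert a t') p'.parts :=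
      congrArg Finpartition.parts h
    have hat : a ∉ t := fun h => ha (Finset.mem_powerset.1 ht h)
    have hat' : a ∉ t' := fun h => ha (Finset.mem_powerset.1 ht' h)
    -- `insert a t` is the only cell containing `a`, so the parts determine `t`.
    have htt : t = t' := by
      have h1 : insert a t ∈ insert (insert a t') p'.parts := hparts ▸ Finset.mem_insert_self _ _
      rcases Finset.mem_insert.1 h1 with h1 | h1
      · rw [← Finset.erase_insert hat, h1, Finset.erase_insert hat']
      · exact absurd h1 (insert_notMem_parts ha p' t)
    subst htt
    have hpp : p = p' := by
      ext1
      rw [← Finset.erase_insert (insert_notMem_parts ha p t), hparts,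
        Finset.erase_insert (insert_notMem_parts ha p' t)]
    rw [hpp]
  · intro q _
    obtain ⟨t, ht, p, h⟩ := exists_addCell ha q
    exact ⟨⟨⟨t, Finset.mem_powerset.2 ht⟩, p⟩, Finset.mem_univ _, h⟩
  · rintro ⟨⟨t, ht⟩, p⟩ _
    have : (addCell ha t (Finset.mem_powerset.1 ht) p).parts = insert (insert a t) p.parts := rfl
    rw [this, Finset.prod_insert (insert_notMem_parts ha p t)]

end CellSum

/-! ### The Poisson law: size biasing and Laplace transform -/

section PoissonLaw

instance (r : ℝ≥0∞) : IsProbabilityMeasure (poissonLaw r) := by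
  unfold poissonLaw
  split_ifs
  · infer_instance
  · exact Measure.isProbabilityMeasure_map (measurable_of_countable _).aemeasurable

lemma lintegral_poissonLaw_coe (r : ℝ≥0) {g : ℝ≥0∞ → ℝ≥0∞} (hg : Measurable g) :
    ∫⁻ x, g x ∂poissonLaw r =
      ∑' k : ℕ, ENNReal.ofReal (Real.exp (-r) * r ^ k / k.factorial) * g k := by
  rw [poissonLaw, if_neg ENNReal.coe_ne_top, lintegral_map hg (measurable_of_countable _),
    ENNReal.toNNReal_coe, poissonMeasure, lintegral_sum_measure]
  simp [lintegral_smul_measure]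

lemma lintegral_poissonLaw_top (g : ℝ≥0∞ → ℝ≥0∞) : ∫⁻ x, g x ∂poissonLaw ∞ = g ∞ := by
  simp [poissonLaw]

/-- The size-biasing identity `E[K g(K)] = r E[g(K + 1)]` of the Poisson law. -/
lemma lintegral_mul_poissonLaw (r : ℝ≥0∞) {g : ℝ≥0∞ → ℝ≥0∞} (hg : Measurable g) :
    ∫⁻ x, x * g x ∂poissonLaw r = r * ∫⁻ x, g (x + 1) ∂poissonLaw r := by
  induction r with
  | top => simp [lintegral_poissonLaw_top]
  | coe r =>
    -- The factor `x` kills the term `k = 0`; after the index shift, `(k + 1) / (k + 1)! = 1 / k!`.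
    rw [lintegral_poissonLaw_coe r (g := fun x => x * g x) (by fun_prop),
      lintegral_poissonLaw_coe r (by fun_prop), tsum_eq_zero_add' ENNReal.summable,
      ← ENNReal.tsum_mul_left]
    simp only [Nat.cast_zero, zero_mul, mul_zero, zero_add]
    refine tsum_congr fun k => ?_
    rw [← ENNReal.ofReal_coe_nnreal, ← mul_assoc, ← mul_assoc, ← ENNReal.ofReal_mul r.coe_nonneg,
      Nat.cast_add_one, ← Nat.cast_add_one, ← ENNReal.ofReal_natCast (k + 1),
      ← ENNReal.ofReal_mul (by positivity)]
    congr 2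
    rw [Nat.factorial_succ]
    push_cast
    field_simp
    ring

/-- The Laplace transform of the Poisson law. -/
lemma lintegral_expNeg_poissonLaw (r a : ℝ≥0∞) :
    ∫⁻ x, expNeg (a * x) ∂poissonLaw r = expNeg (r * (1 - expNeg a)) := by
  induction r with
  | top =>
    rw [lintegral_poissonLaw_top]
    rcases eq_or_ne a 0 with rfl | ha
    · simp
    · have : 1 - expNeg a ≠ 0 := by
        rw [← pos_iff_ne_zero, tsub_pos_iff_lt, expNeg, EReal.exp_lt_one_iff]
        simpa [pos_iff_ne_zero] using ha
      rw [ENNReal.mul_top ha, ENNReal.top_mul this]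
  | coe r =>
    rw [lintegral_poissonLaw_coe r (by fun_prop)]
    -- Working with `q = e^{-a}` includes `a = ∞` as `q = 0`; the sum becomes the exponential series
    -- at `r q`.
    obtain ⟨q, hq, hq1, hqa⟩ : ∃ q : ℝ, 0 ≤ q ∧ q ≤ 1 ∧ expNeg a = ENNReal.ofReal q :=
      ⟨(expNeg a).toReal, ENNReal.toReal_nonneg,
        ENNReal.toReal_le_of_le_ofReal zero_le_one (by simpa using expNeg_le_one a),
        (ENNReal.ofReal_toReal (expNeg_ne_top a)).symm⟩
    have hpow : ∀ k : ℕ, expNeg (a * k) = ENNReal.ofReal (q ^ k) := by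
      intro k
      have := expNeg_sum (Finset.range k) (fun _ => a)
      rw [Finset.sum_const, Finset.prod_const, Finset.card_range, nsmul_eq_mul, mul_comm] at this
      rw [this, hqa, ENNReal.ofReal_pow hq]
    have hr : (r : ℝ≥0∞) * (1 - expNeg a) = ENNReal.ofReal (r * (1 - q)) := by
      rw [hqa, ← ENNReal.ofReal_one, ← ENNReal.ofReal_sub _ hq, ← ENNReal.ofReal_coe_nnreal,
        ← ENNReal.ofReal_mul r.coe_nonneg]
    rw [hr, expNeg_ofReal (mul_nonneg r.coe_nonneg (by linarith))]
    have hterm : ∀ k : ℕ, ENNReal.ofReal (Real.exp (-r) * r ^ k / k.factorial) * expNeg (a * k) =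
        ENNReal.ofReal (Real.exp (-r) * ((r * q) ^ k / k.factorial)) := by
      intro k
      rw [hpow, ← ENNReal.ofReal_mul (by positivity)]
      congr 1
      rw [mul_pow]
      ring
    simp_rw [hterm]
    have hs : HasSum (fun k : ℕ => Real.exp (-r) * ((r * q) ^ k / k.factorial))
        (Real.exp (-r) * Real.exp (r * q)) := by
      have := (NormedSpace.expSeries_div_hasSum_exp ((r : ℝ) * q)).mul_left (Real.exp (-r))
      rwa [← Real.exp_eq_exp_ℝ] at this
    rw [← ENNReal.ofReal_tsum_of_nonneg (fun k => by positivity) hs.summable, hs.tsum_eq,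
      ← Real.exp_add]
    congr 2
    ring

end PoissonLaw

/-! ### Vectors of independent Poisson variables -/

section PoissonVector

variable {ι : Type*} [Fintype ι]

/-- The Mecke equation for a vector of independent Poisson variables. -/
lemma lintegral_mul_pi_poissonLaw [DecidableEq ι] (r : ι → ℝ≥0∞)
    {Φ : (ι → ℝ≥0∞) → ℝ≥0∞} (hΦ : Measurable Φ) (j : ι) :
    ∫⁻ x, x j * Φ x ∂Measure.pi (fun y => poissonLaw (r y)) =
      r j * ∫⁻ x, Φ (x + Pi.single j 1) ∂Measure.pi (fun y => poissonLaw (r y)) := by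
  have hshift : Measurable fun x : ι → ℝ≥0∞ => Φ (x + Pi.single j 1) := by fun_prop
  rw [← lintegral_const_mul _ hshift]
  -- Integrating out coordinate `j` alone reduces the claim to the one-dimensional size-biasing
  -- identity.
  refine lintegral_eq_of_lmarginal_eq {j} (by fun_prop) (by fun_prop) ?_
  ext x
  rw [lmarginal_singleton, lmarginal_singleton]
  have hup : ∀ z, Function.update x j z + Pi.single j 1 = Function.update x j (z + 1) := by
    intro z
    ext y
    by_cases h : y = j
    · subst h; simp
    · simp [h]
  simp only [Function.update_self, hup]
  rw [lintegral_const_mul _ (by fun_prop)]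
  exact lintegral_mul_poissonLaw (r j) (g := fun z => Φ (Function.update x j z)) (by fun_prop)

lemma lintegral_expNeg_pi_poissonLaw (r a : ι → ℝ≥0∞) :
    ∫⁻ x, expNeg (∑ y, a y * x y) ∂Measure.pi (fun y => poissonLaw (r y)) =
      expNeg (∑ y, r y * (1 - expNeg (a y))) := by
  simp_rw [expNeg_sum, ← lintegral_expNeg_poissonLaw]
  have hind : iIndepFun (fun (y : ι) (x : ι → ℝ≥0∞) => expNeg (a y * x y))
      (Measure.pi (fun y => poissonLaw (r y))) :=
    iIndepFun_pi (X := fun y z => expNeg (a y * z)) (fun y => by fun_prop)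
  rw [lintegral_prod_eq_prod_lintegral_of_indepFun Finset.univ _ hind (fun y => by fun_prop)]
  refine Finset.prod_congr rfl fun y _ => ?_
  exact (measurePreserving_eval (fun y => poissonLaw (r y)) y).lintegral_comp
    (f := fun z => expNeg (a y * z)) (by fun_prop)

/-- Exponentially tilted joint moments of linear functions of a Poisson vector. -/
lemma lintegral_expNeg_mul_prod_pi_poissonLaw {α : Type*} [DecidableEq α] (r a : ι → ℝ≥0∞)
    (c : ι → α → ℝ≥0∞) (s : Finset α) :
    ∫⁻ x, expNeg (∑ y, a y * x y) * ∏ i ∈ s, ∑ y, c y i * x y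
        ∂Measure.pi (fun y => poissonLaw (r y)) =
      expNeg (∑ y, r y * (1 - expNeg (a y))) *
        cellSum s (fun C => ∑ y, r y * (expNeg (a y) * ∏ i ∈ C, c y i)) := by
  classical
  -- The recursion passes to `s \ t` for every subset `t`, so strong induction is required.
  induction s using Finset.strongInduction with
  | H s ih =>
  rcases s.eq_empty_or_nonempty with rfl | ⟨b, hb⟩
  · simp [lintegral_expNeg_pi_poissonLaw]
  obtain ⟨s, hbs, rfl⟩ : ∃ u, b ∉ u ∧ insert b u = s :=
    ⟨s.erase b, Finset.notMem_erase b s, Finset.insert_erase hb⟩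
  have hlin : ∀ (d : ι → ℝ≥0∞) (x : ι → ℝ≥0∞) (j : ι),
      ∑ y, d y * (x + Pi.single j 1 : ι → ℝ≥0∞) y = d j + ∑ y, d y * x y := by
    intro d x j
    simp_rw [Pi.add_apply, mul_add, Finset.sum_add_distrib]
    rw [add_comm]
    congr 1
    simp [Pi.single_apply]
  have hj : ∀ j : ι, ∫⁻ x, c j b * (x j * (expNeg (∑ y, a y * x y) *
        ∏ i ∈ s, ∑ y, c y i * x y)) ∂Measure.pi (fun y => poissonLaw (r y)) =
      ∑ t ∈ s.powerset, r j * (expNeg (a j) * ∏ i ∈ insert b t, c j i) *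
        (expNeg (∑ y, r y * (1 - expNeg (a y))) *
          cellSum (s \ t) (fun C => ∑ y, r y * (expNeg (a y) * ∏ i ∈ C, c y i))) := by
    intro j
    rw [lintegral_const_mul _ (by fun_prop), lintegral_mul_pi_poissonLaw r (by fun_prop) j]
    -- `Finset.prod_add` runs over subsets `t`: the indices in `t` take the contribution of the
    -- added point and join the cell of `b`.
    simp_rw [hlin, expNeg_add, Finset.prod_add, Finset.mul_sum]
    rw [lintegral_finsetSum _ (fun t _ => by fun_prop), Finset.mul_sum, Finset.mul_sum]
    refine Finset.sum_congr rfl fun t ht => ?_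
    have hts := Finset.mem_powerset.1 ht
    have hbt : b ∉ t := fun h => hbs (hts h)
    rw [← ih (s \ t) (Finset.ssubset_of_subset_of_ssubset Finset.sdiff_subset
      (Finset.ssubset_insert hbs)), Finset.prod_insert hbt, ← lintegral_const_mul _ (by fun_prop),
      ← lintegral_const_mul _ (by fun_prop), ← lintegral_const_mul _ (by fun_prop)]
    refine lintegral_congr fun x => ?_
    ring
  have hexp : ∀ x : ι → ℝ≥0∞, expNeg (∑ y, a y * x y) *
      ∏ i ∈ insert b s, ∑ y, c y i * x y =
      ∑ j, c j b * (x j * (expNeg (∑ y, a y * x y) * ∏ i ∈ s, ∑ y, c y i * x y)) := by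
    intro x
    rw [Finset.prod_insert hbs, mul_left_comm, Finset.sum_mul]
    simp_rw [mul_assoc]
  simp_rw [hexp]
  rw [lintegral_finsetSum _ (fun t _ => by fun_prop)]
  simp_rw [hj]
  rw [Finset.sum_comm, cellSum_insert hbs, Finset.mul_sum]
  refine Finset.sum_congr rfl fun t _ => ?_
  rw [← Finset.sum_mul]
  ring

end PoissonVector

/-! ### From Poisson vectors to integrals against a Poisson random measure -/

section PoissonRandomMeasure

variable {S V : Type*} [MeasurableSpace S] [MeasurableSpace V] {P : Measure S}
  [IsProbabilityMeasure P] {N : S → Measure V} {ν : Measure V}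

/-- The joint law of the masses of finitely many disjoint sets. -/
lemma IsPoissonRandomMeasure.map_eq_pi (hN : IsPoissonRandomMeasure P N ν) {ι : Type*} [Fintype ι]
    {B : ι → Set V} (hB : ∀ y, MeasurableSet (B y))
    (hd : Pairwise (fun y z => Disjoint (B y) (B z))) :
    P.map (fun s y => N s (B y)) = Measure.pi (fun y => poissonLaw (ν (B y))) := by
  have hmeas : ∀ y, Measurable fun s => N s (B y) := fun y =>
    (Measure.measurable_coe (hB y)).comp hN.measurable
  let e := Fintype.equivFin ι
  have hind := hN.indep (Fintype.card ι) (fun j => B (e.symm j)) (fun j => hB _)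
    (fun i j hij => hd (e.symm.injective.ne hij))
  have hind' : iIndepFun (fun y s => N s (B y)) P := by
    simpa using hind.precomp e.injective
  rw [(iIndepFun_iff_map_fun_eq_pi_map fun y => (hmeas y).aemeasurable).1 hind']
  simp_rw [hN.law _ (hB _)]

lemma lintegral_comp_simpleFunc {β : Type*} (J : SimpleFunc V β) (g : β → ℝ≥0∞) (m : Measure V) :
    ∫⁻ v, g (J v) ∂m = ∑ y : J.range, g y * m (J ⁻¹' {(y : β)}) := by
  have h := SimpleFunc.map_lintegral (μ := m) g J
  rw [← SimpleFunc.lintegral_eq_lintegral, ← Finset.sum_coe_sort] at h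
  simpa using h

/-- Exponentially tilted joint moments of the integrals of simple functions. -/
lemma IsPoissonRandomMeasure.lintegral_simpleFunc (hN : IsPoissonRandomMeasure P N ν)
    {α : Type*} [Fintype α] [DecidableEq α] (J : SimpleFunc V (α → ℝ≥0∞)) (w : α → ℝ≥0∞) :
    ∫⁻ s, expNeg (∑ i, w i * ∫⁻ v, J v i ∂N s) * ∏ i, ∫⁻ v, J v i ∂N s ∂P =
      expNeg (laplaceExponent ν fun v => ∑ i, w i * J v i) *
        cellSum Finset.univ
          (fun C => ∫⁻ v, expNeg (∑ i, w i * J v i) * ∏ i ∈ C, J v i ∂ν) := by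
  have hB : ∀ y : J.range, MeasurableSet (J ⁻¹' {(y : α → ℝ≥0∞)}) :=
    fun y => J.measurableSet_fiber y
  have hd : Pairwise (fun y z : J.range => Disjoint (J ⁻¹' {(y : α → ℝ≥0∞)})
      (J ⁻¹' {(z : α → ℝ≥0∞)})) := by
    intro y z hyz
    exact Disjoint.preimage _ (Set.disjoint_singleton.2 fun h => hyz (Subtype.ext h))
  have hmeas : Measurable fun s (y : J.range) => N s (J ⁻¹' {(y : α → ℝ≥0∞)}) :=
    measurable_pi_lambda _ fun y => (Measure.measurable_coe (hB y)).comp hN.measurable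
  -- Fibres of infinite intensity, such as the one over `0`, cause no trouble: the vector identity
  -- allows means equal to `∞`.
  have hmain := lintegral_expNeg_mul_prod_pi_poissonLaw
    (fun y : J.range => ν (J ⁻¹' {(y : α → ℝ≥0∞)})) (fun y => ∑ i, w i * y.1 i)
    (fun y => y.1) Finset.univ
  rw [← hN.map_eq_pi hB hd, lintegral_map (by fun_prop) hmeas] at hmain
  have hlin : ∀ s i, ∫⁻ v, J v i ∂N s =
      ∑ y : J.range, y.1 i * N s (J ⁻¹' {(y : α → ℝ≥0∞)}) := fun s i =>
    lintegral_comp_simpleFunc J (fun y => y i) (N s)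
  have hsum : ∀ s, ∑ i, w i * ∫⁻ v, J v i ∂N s =
      ∑ y : J.range, (∑ i, w i * y.1 i) * N s (J ⁻¹' {(y : α → ℝ≥0∞)}) := by
    intro s
    simp_rw [hlin, Finset.mul_sum, Finset.sum_mul, mul_assoc]
    exact Finset.sum_comm
  simp_rw [hsum, hlin]
  rw [hmain, laplaceExponent, lintegral_comp_simpleFunc J (fun y => 1 - expNeg (∑ i, w i * y i))]
  simp_rw [mul_comm (ν _)]
  congr 2
  ext C
  rw [lintegral_comp_simpleFunc J (fun y => expNeg (∑ i, w i * y i) * ∏ i ∈ C, y i)]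

/-- Increasing approximation of finitely many functions by simple functions. -/
def jointApprox {α : Type*} [Finite α] (f : α → V → ℝ≥0∞) (k : ℕ) : SimpleFunc V (α → ℝ≥0∞) where
  toFun v i := SimpleFunc.eapprox (f i) k v
  measurableSet_fiber' y := by
    have h : Measurable fun v i => SimpleFunc.eapprox (f i) k v :=
      measurable_pi_lambda _ fun i => (SimpleFunc.eapprox (f i) k).measurable
    have := Fintype.ofFinite α
    exact h (measurableSet_singleton y)
  finite_range' := by
    refine (Set.Finite.pi' fun i => (SimpleFunc.eapprox (f i) k).finite_range).subset ?_
    rintro _ ⟨v, rfl⟩ i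
    exact ⟨v, rfl⟩

section Approx

variable {α : Type*} [Finite α] {f : α → V → ℝ≥0∞}

lemma jointApprox_mono (f : α → V → ℝ≥0∞) (i : α) (v : V) :
    Monotone fun k => jointApprox f k v i :=
  fun _ _ h => SimpleFunc.monotone_eapprox (f i) h v

lemma jointApprox_le (hf : ∀ i, Measurable (f i)) (k : ℕ) (v : V) (i : α) :
    jointApprox f k v i ≤ f i v :=
  (le_iSup (fun k => SimpleFunc.eapprox (f i) k v) k).trans_eq
    (SimpleFunc.iSup_eapprox_apply (hf i) v)

lemma tendsto_jointApprox (hf : ∀ i, Measurable (f i)) (i : α) (v : V) :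
    Filter.Tendsto (fun k => jointApprox f k v i) Filter.atTop (nhds (f i v)) :=
  SimpleFunc.tendsto_eapprox (hf i) v

@[fun_prop]
lemma measurable_jointApprox (f : α → V → ℝ≥0∞) (k : ℕ) (i : α) :
    Measurable fun v => jointApprox f k v i :=
  (SimpleFunc.eapprox (f i) k).measurable

lemma tendsto_lintegral_jointApprox (hf : ∀ i, Measurable (f i)) (i : α) (m : Measure V) :
    Filter.Tendsto (fun k => ∫⁻ v, jointApprox f k v i ∂m) Filter.atTop
      (nhds (∫⁻ v, f i v ∂m)) :=
  lintegral_tendsto_of_tendsto_of_monotone (fun k => by fun_prop)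
    (Filter.Eventually.of_forall fun v => jointApprox_mono f i v)
    (Filter.Eventually.of_forall fun v => tendsto_jointApprox hf i v)

lemma monotone_lintegral_jointApprox (f : α → V → ℝ≥0∞) (i : α) (m : Measure V) :
    Monotone fun k => ∫⁻ v, jointApprox f k v i ∂m :=
  fun _ _ h => lintegral_mono fun v => jointApprox_mono f i v h

end Approx

/-- Products of increasing sequences in `[0, ∞]` converge to the product of the limits, also in the
presence of `0 * ∞`. -/
lemma tendsto_prod_of_monotone {ι : Type*} (s : Finset ι) {u : ι → ℕ → ℝ≥0∞} {a : ι → ℝ≥0∞}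
    (hu : ∀ i, Monotone (u i)) (ha : ∀ i, Filter.Tendsto (u i) Filter.atTop (nhds (a i))) :
    Filter.Tendsto (fun k => ∏ i ∈ s, u i k) Filter.atTop (nhds (∏ i ∈ s, a i)) := by
  classical
  have ha' : ∀ i, a i = ⨆ k, u i k := fun i =>
    tendsto_nhds_unique (ha i) (tendsto_atTop_iSup (hu i))
  have hmono : ∀ s : Finset ι, Monotone fun k => ∏ i ∈ s, u i k := fun s _ _ h =>
    Finset.prod_le_prod' fun i _ => hu i h
  have heq : ∏ i ∈ s, a i = ⨆ k, ∏ i ∈ s, u i k := by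
    induction s using Finset.induction_on with
    | empty => simp
    | insert b s hb ih =>
      simp_rw [Finset.prod_insert hb]
      rw [ih, ha' b]
      refine le_antisymm ?_ (iSup_le fun k => mul_le_mul' (le_iSup (u b) k)
        (le_iSup (fun k => ∏ i ∈ s, u i k) k))
      rw [ENNReal.iSup_mul]
      refine iSup_le fun j => ?_
      rw [ENNReal.mul_iSup]
      refine iSup_le fun k => ?_
      exact (mul_le_mul' (hu b (le_max_left j k)) (hmono s (le_max_right j k))).trans
        (le_iSup (fun k => u b k * ∏ i ∈ s, u i k) (max j k))
  rw [heq]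
  exact tendsto_atTop_iSup (hmono s)

lemma tendsto_cellSum_of_monotone {α : Type*} [DecidableEq α] (s : Finset α)
    {I : ℕ → Finset α → ℝ≥0∞} {I' : Finset α → ℝ≥0∞} (hI : ∀ C, Monotone fun k => I k C)
    (h : ∀ C, Filter.Tendsto (fun k => I k C) Filter.atTop (nhds (I' C))) :
    Filter.Tendsto (fun k => cellSum s (I k)) Filter.atTop (nhds (cellSum s I')) :=
  tendsto_finsetSum _ fun p _ => tendsto_prod_of_monotone p.parts (u := fun C k => I k C) hI h

/-- Tilted integrands are not monotone in the approximation, so finiteness of the limits replaces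
monotonicity. Only nonempty cells matter, since partitions have no empty cell. -/
lemma tendsto_cellSum_of_ne_top {α : Type*} [DecidableEq α] (s : Finset α)
    {I : ℕ → Finset α → ℝ≥0∞} {I' : Finset α → ℝ≥0∞} (hI : ∀ C, C.Nonempty → I' C ≠ ∞)
    (h : ∀ C, C.Nonempty → Filter.Tendsto (fun k => I k C) Filter.atTop (nhds (I' C))) :
    Filter.Tendsto (fun k => cellSum s (I k)) Filter.atTop (nhds (cellSum s I')) :=
  tendsto_finsetSum _ fun p _ => ENNReal.tendsto_finsetProd_of_ne_top _
    (fun C hC => h C (p.nonempty_of_mem_parts hC)) (fun C hC => hI C (p.nonempty_of_mem_parts hC))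

/-- Joint moments of the integrals of nonnegative measurable functions. -/
theorem IsPoissonRandomMeasure.lintegral_prod (hN : IsPoissonRandomMeasure P N ν)
    {α : Type*} [Fintype α] [DecidableEq α] {f : α → V → ℝ≥0∞} (hf : ∀ i, Measurable (f i)) :
    ∫⁻ s, ∏ i, ∫⁻ v, f i v ∂N s ∂P =
      cellSum Finset.univ (fun C => ∫⁻ v, ∏ i ∈ C, f i v ∂ν) := by
  have hmeas : ∀ k i, Measurable fun s => ∫⁻ v, jointApprox f k v i ∂N s := fun k i =>
    (Measure.measurable_lintegral (by fun_prop)).comp hN.measurable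
  have h : ∀ k, ∫⁻ s, ∏ i, ∫⁻ v, jointApprox f k v i ∂N s ∂P =
      cellSum Finset.univ (fun C => ∫⁻ v, ∏ i ∈ C, jointApprox f k v i ∂ν) := by
    intro k
    -- Zero weights turn every exponential into `1` and the Laplace exponent into `0`.
    simpa [laplaceExponent] using hN.lintegral_simpleFunc (jointApprox f k) 0
  have hleft : Filter.Tendsto (fun k => ∫⁻ s, ∏ i, ∫⁻ v, jointApprox f k v i ∂N s ∂P)
      Filter.atTop (nhds (∫⁻ s, ∏ i, ∫⁻ v, f i v ∂N s ∂P)) := by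
    refine lintegral_tendsto_of_tendsto_of_monotone (fun k => ?_) ?_ ?_
    · exact (Finset.measurable_fun_prod _ fun i _ => hmeas k i).aemeasurable
    · exact Filter.Eventually.of_forall fun s _ _ hkl =>
        Finset.prod_le_prod' fun i _ => monotone_lintegral_jointApprox f i (N s) hkl
    · exact Filter.Eventually.of_forall fun s => tendsto_prod_of_monotone _
        (fun i => monotone_lintegral_jointApprox f i (N s))
        (fun i => tendsto_lintegral_jointApprox hf i (N s))
  refine tendsto_nhds_unique hleft ?_
  simp_rw [h]
  have hmono : ∀ (C : Finset α) v, Monotone fun k => ∏ i ∈ C, jointApprox f k v i :=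
    fun C v _ _ hkl => Finset.prod_le_prod' fun i _ => jointApprox_mono f i v hkl
  refine tendsto_cellSum_of_monotone _ (fun C _ _ hkl => lintegral_mono fun v => hmono C v hkl)
    fun C => lintegral_tendsto_of_tendsto_of_monotone (fun k => ?_)
      (Filter.Eventually.of_forall (hmono C)) (Filter.Eventually.of_forall fun v =>
        tendsto_prod_of_monotone _ (fun i => jointApprox_mono f i v)
          fun i => tendsto_jointApprox hf i v)
  exact (Finset.measurable_fun_prod _ fun i _ => measurable_jointApprox f k i).aemeasurable

/-! ### Exponentially tilted moments by dominated convergence -/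

section Tilted

variable {α : Type*} [Fintype α]

/-- `∏_{i ∈ C} xᵢ e^{-∑ wᵢ xᵢ}` is bounded by a multiple of `1 - e^{-∑ wᵢ xᵢ}`. -/
lemma expNeg_mul_prod_le {w : α → ℝ≥0∞} (hw : ∀ i, w i ≠ 0) (hw' : ∀ i, w i ≠ ∞) {C : Finset α}
    (hC : C.Nonempty) (x : α → ℝ≥0∞) :
    expNeg (∑ i, w i * x i) * ∏ i ∈ C, x i ≤
      (∏ i ∈ C, (w i)⁻¹) * C.card.factorial * (1 - expNeg (∑ i, w i * x i)) := by
  have h1 : ∀ i, x i ≤ (w i)⁻¹ * ∑ i, w i * x i := by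
    intro i
    calc x i = (w i)⁻¹ * (w i * x i) := by
          rw [← mul_assoc, ENNReal.inv_mul_cancel (hw i) (hw' i), one_mul]
      _ ≤ _ := mul_le_mul_right (Finset.single_le_sum (f := fun i => w i * x i)
          (fun _ _ => zero_le) (Finset.mem_univ i)) _
  calc expNeg (∑ i, w i * x i) * ∏ i ∈ C, x i
      ≤ expNeg (∑ i, w i * x i) * ∏ i ∈ C, ((w i)⁻¹ * ∑ i, w i * x i) :=
        mul_le_mul_right (Finset.prod_le_prod' fun i _ => h1 i) _
    _ = (∏ i ∈ C, (w i)⁻¹) * ((∑ i, w i * x i) ^ C.card * expNeg (∑ i, w i * x i)) := by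
        rw [Finset.prod_mul_distrib, Finset.prod_const]
        ring
    _ ≤ _ := by
        rw [mul_assoc]
        exact mul_le_mul_right (pow_mul_expNeg_le _ hC.card_pos.ne') _

lemma lintegral_expNeg_mul_prod_lt_top {w : α → ℝ≥0∞} (hw : ∀ i, w i ≠ 0) (hw' : ∀ i, w i ≠ ∞)
    {f : α → V → ℝ≥0∞} (hf : ∀ i, Measurable (f i))
    (hΛ : laplaceExponent ν (fun v => ∑ i, w i * f i v) < ∞) {C : Finset α} (hC : C.Nonempty) :
    ∫⁻ v, expNeg (∑ i, w i * f i v) * ∏ i ∈ C, f i v ∂ν < ∞ := by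
  refine (lintegral_mono fun v => expNeg_mul_prod_le hw hw' hC fun i => f i v).trans_lt ?_
  rw [lintegral_const_mul _ (by fun_prop)]
  refine ENNReal.mul_lt_top (ENNReal.mul_lt_top ?_ (by simp)) hΛ
  exact ENNReal.prod_lt_top fun i _ => ENNReal.inv_lt_top.2 (pos_iff_ne_zero.2 (hw i))

lemma tendsto_expNeg_sum_jointApprox {w : α → ℝ≥0∞} (hw' : ∀ i, w i ≠ ∞)
    {f : α → V → ℝ≥0∞} (hf : ∀ i, Measurable (f i)) (v : V) :
    Filter.Tendsto (fun k => expNeg (∑ i, w i * jointApprox f k v i)) Filter.atTop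
      (nhds (expNeg (∑ i, w i * f i v))) :=
  (continuous_expNeg.tendsto _).comp (tendsto_finsetSum _ fun i _ =>
    ENNReal.Tendsto.const_mul (tendsto_jointApprox hf i v) (Or.inr (hw' i)))

/-- Exponentially tilted joint moments of the integrals of nonnegative finite functions. -/
theorem IsPoissonRandomMeasure.lintegral_expNeg_mul_prod [DecidableEq α]
    (hN : IsPoissonRandomMeasure P N ν) {w : α → ℝ≥0∞} (hw : ∀ i, w i ≠ 0) (hw' : ∀ i, w i ≠ ∞)
    {f : α → V → ℝ≥0∞} (hf : ∀ i, Measurable (f i)) (hf' : ∀ i v, f i v ≠ ∞)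
    (hΛ : laplaceExponent ν (fun v => ∑ i, w i * f i v) < ∞) :
    ∫⁻ s, ∏ i, (expNeg (w i * ∫⁻ v, f i v ∂N s) * ∫⁻ v, f i v ∂N s) ∂P =
      expNeg (laplaceExponent ν fun v => ∑ i, w i * f i v) *
        cellSum Finset.univ (fun C => ∫⁻ v, expNeg (∑ i, w i * f i v) * ∏ i ∈ C, f i v ∂ν) := by
  have hmeas : ∀ k i, Measurable fun s => ∫⁻ v, jointApprox f k v i ∂N s := fun k i =>
    (Measure.measurable_lintegral (by fun_prop)).comp hN.measurable
  have h := fun k => hN.lintegral_simpleFunc (jointApprox f k) w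
  -- The exponential is distributed over the factors of the expectation; the next rewrite restores
  -- the sums on the other side.
  simp_rw [expNeg_sum Finset.univ, ← Finset.prod_mul_distrib] at h
  simp_rw [← expNeg_sum Finset.univ] at h
  have hle : ∀ k v, ∑ i, w i * jointApprox f k v i ≤ ∑ i, w i * f i v := fun k v =>
    Finset.sum_le_sum fun i _ => mul_le_mul_right (jointApprox_le hf k v i) _
  have hfin : ∏ i, (w i)⁻¹ < ∞ :=
    ENNReal.prod_lt_top fun i _ => ENNReal.inv_lt_top.2 (pos_iff_ne_zero.2 (hw i))
  have hleft : Filter.Tendsto (fun k => ∫⁻ s, ∏ i, (expNeg (w i * ∫⁻ v, jointApprox f k v i ∂N s) *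
      ∫⁻ v, jointApprox f k v i ∂N s) ∂P) Filter.atTop
      (nhds (∫⁻ s, ∏ i, (expNeg (w i * ∫⁻ v, f i v ∂N s) * ∫⁻ v, f i v ∂N s) ∂P)) := by
    refine tendsto_lintegral_of_dominated_convergence (fun _ => ∏ i, (w i)⁻¹) (fun k => ?_)
      (fun k => ?_) ?_ ?_
    · exact Finset.measurable_fun_prod _ fun i _ => by
        have := hmeas k i
        fun_prop
    · exact Filter.Eventually.of_forall fun s => Finset.prod_le_prod' fun i _ =>
        expNeg_mul_mul_le (hw i) (hw' i) _
    · simpa using hfin.ne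
    · refine Filter.Eventually.of_forall fun s => ENNReal.tendsto_finsetProd_of_ne_top _ ?_ ?_
      -- The limiting integral may be infinite, so continuity at `∞` is needed here.
      · exact fun i _ => ((continuous_expNeg_mul_mul (hw i) (hw' i)).tendsto _).comp
          (tendsto_lintegral_jointApprox hf i (N s))
      · exact fun i _ => ((expNeg_mul_mul_le (hw i) (hw' i) _).trans_lt
          (ENNReal.inv_lt_top.2 (pos_iff_ne_zero.2 (hw i)))).ne
  refine tendsto_nhds_unique hleft ?_
  simp_rw [h]
  have hcell : ∀ C : Finset α, C.Nonempty → Filter.Tendsto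
      (fun k => ∫⁻ v, expNeg (∑ i, w i * jointApprox f k v i) * ∏ i ∈ C, jointApprox f k v i ∂ν)
      Filter.atTop (nhds (∫⁻ v, expNeg (∑ i, w i * f i v) * ∏ i ∈ C, f i v ∂ν)) := by
    intro C hC
    -- The bound for the `k`-th approximation involves its own exponent; replacing that by the
    -- larger limiting exponent makes the majorant independent of `k`, and it is integrable by `hΛ`.
    refine tendsto_lintegral_of_dominated_convergence (fun v => (∏ i ∈ C, (w i)⁻¹) *
      C.card.factorial * (1 - expNeg (∑ i, w i * f i v))) (fun k => by fun_prop)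
      (fun k => ?_) ?_ ?_
    · exact Filter.Eventually.of_forall fun v =>
        (expNeg_mul_prod_le hw hw' hC fun i => jointApprox f k v i).trans
          (mul_le_mul_right (tsub_le_tsub_left (expNeg_antitone (hle k v)) _) _)
    · rw [lintegral_const_mul _ (by fun_prop)]
      refine (ENNReal.mul_lt_top (ENNReal.mul_lt_top ?_ (by simp)) hΛ).ne
      exact ENNReal.prod_lt_top fun i _ => ENNReal.inv_lt_top.2 (pos_iff_ne_zero.2 (hw i))
    · refine Filter.Eventually.of_forall fun v => ENNReal.Tendsto.mul
        (tendsto_expNeg_sum_jointApprox hw' hf v) (Or.inr ?_)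
        (ENNReal.tendsto_finsetProd_of_ne_top _ (fun i _ => tendsto_jointApprox hf i v)
          fun i _ => hf' i v) (Or.inr (expNeg_ne_top _))
      exact ENNReal.prod_ne_top fun i _ => hf' i v
  have hcell_top : ∀ C : Finset α, C.Nonempty →
      ∫⁻ v, expNeg (∑ i, w i * f i v) * ∏ i ∈ C, f i v ∂ν ≠ ∞ := fun C hC =>
    (lintegral_expNeg_mul_prod_lt_top hw hw' hf hΛ hC).ne
  have hlap : Filter.Tendsto (fun k => laplaceExponent ν fun v => ∑ i, w i * jointApprox f k v i)
      Filter.atTop (nhds (laplaceExponent ν fun v => ∑ i, w i * f i v)) := by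
    refine lintegral_tendsto_of_tendsto_of_monotone (fun k => by fun_prop) ?_ ?_
    · exact Filter.Eventually.of_forall fun v _ _ hkl => tsub_le_tsub_left (expNeg_antitone
        (Finset.sum_le_sum fun i _ => mul_le_mul_right (jointApprox_mono f i v hkl) _)) _
    · exact Filter.Eventually.of_forall fun v => ENNReal.Tendsto.sub tendsto_const_nhds
        (tendsto_expNeg_sum_jointApprox hw' hf v) (Or.inl ENNReal.one_ne_top)
  refine ENNReal.Tendsto.mul ((continuous_expNeg.tendsto _).comp hlap) (Or.inr ?_)
    (tendsto_cellSum_of_ne_top _ hcell_top hcell) (Or.inr (expNeg_ne_top _))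
  exact ENNReal.sum_ne_top.2 fun p _ => ENNReal.prod_ne_top fun C hC =>
    hcell_top C (p.nonempty_of_mem_parts hC)

end Tilted

end PoissonRandomMeasure

/-! ### Finite powers of measures: Tonelli and measurability -/

section PiMeasure

variable {V : Type*} [MeasurableSpace V]

/-- Tonelli's theorem for a product of functions of one coordinate each. -/
lemma lintegral_pi_prod {n : ℕ} (m : Measure V) [SigmaFinite m] {f : Fin n → V → ℝ≥0∞}
    (hf : ∀ i, Measurable (f i)) :
    ∫⁻ v, ∏ i, f i (v i) ∂Measure.pi (fun _ : Fin n => m) = ∏ i, ∫⁻ v, f i v ∂m := by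
  induction n with
  | zero => simp
  | succ n ih =>
    rw [← ((measurePreserving_piFinSuccAbove (fun _ : Fin (n + 1) => m) 0).symm).lintegral_comp
      (by fun_prop)]
    simp_rw [MeasurableEquiv.piFinSuccAbove_symm_apply, Fin.insertNthEquiv, Fin.prod_univ_succ,
      Fin.insertNth_zero, Equiv.coe_fn_mk, Fin.cons_succ, Fin.cons_zero]
    rw [← ih fun i => hf i.succ, ← lintegral_prod_mul (hf 0).aemeasurable
      (Finset.measurable_fun_prod _ fun i _ =>
        (hf i.succ).comp (measurable_pi_apply i)).aemeasurable]
    rfl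

variable {S : Type*} [MeasurableSpace S]

/-- Rectangles form a generating π-system, on which the power is a product of measurable masses;
finiteness allows the extension to all measurable sets. -/
lemma measurable_pi_of_isFiniteMeasure {ι : Type*} [Fintype ι] {M : S → Measure V}
    [∀ s, IsFiniteMeasure (M s)] (hM : Measurable M) :
    Measurable fun s => Measure.pi (fun _ : ι => M s) := by
  refine Measurable.measure_of_isPiSystem generateFrom_pi.symm isPiSystem_pi ?_ ?_
  · rintro _ ⟨t, ht, rfl⟩
    simp_rw [Measure.pi_pi]
    exact Finset.measurable_fun_prod _ fun i _ =>
      (Measure.measurable_coe (ht i (Set.mem_univ i))).comp hM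
  · simp_rw [Measure.pi_univ]
    exact Finset.measurable_fun_prod _ fun i _ => (Measure.measurable_coe .univ).comp hM

lemma sigmaFinite_of_iUnion {m : Measure V} {A : ℕ → Set V} (hA : ∀ k, m (A k) < ∞)
    (hU : ⋃ k, A k = Set.univ) : SigmaFinite m :=
  ⟨⟨⟨A, fun _ => trivial, hA, hU⟩⟩⟩

/-- A measurable family of measures that are finite on common sets `A₀ ⊆ A₁ ⊆ ⋯` exhausting the
space has measurable finite powers. -/
lemma measurable_pi_of_finite_on {ι : Type*} [Fintype ι] {M : S → Measure V} (hM : Measurable M)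
    {A : ℕ → Set V} (hmono : Monotone A) (hmeas : ∀ k, MeasurableSet (A k))
    (hU : ⋃ k, A k = Set.univ) (hA : ∀ s k, M s (A k) < ∞) :
    Measurable fun s => Measure.pi (fun _ : ι => M s) := by
  have hσ : ∀ s, SigmaFinite (M s) := fun s => sigmaFinite_of_iUnion (hA s) hU
  rw [Measure.measurable_measure]
  intro B hB
  have hboxU : ⋃ k, Set.univ.pi (fun _ : ι => A k) = Set.univ := by
    rw [Set.iUnion_univ_pi_of_monotone fun _ => hmono]
    simp [hU]
  have hbox : Monotone fun k => B ∩ Set.univ.pi (fun _ : ι => A k) := fun _ _ h =>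
    Set.inter_subset_inter_right _ (Set.pi_mono fun _ _ => hmono h)
  -- Exhausting by the boxes `A_k^ι` writes the power as a supremum of powers of finite
  -- restrictions.
  have heq : ∀ s, Measure.pi (fun _ : ι => M s) B =
      ⨆ k, Measure.pi (fun _ : ι => (M s).restrict (A k)) B := by
    intro s
    conv_lhs => rw [← Set.inter_univ B, ← hboxU, Set.inter_iUnion, hbox.measure_iUnion]
    refine iSup_congr fun k => ?_
    rw [← Measure.restrict_pi_pi, Measure.restrict_apply hB]
  simp_rw [heq]
  refine Measurable.iSup fun k => ?_
  have hfin : ∀ s, IsFiniteMeasure ((M s).restrict (A k)) := fun s =>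
    isFiniteMeasure_restrict.2 (hA s k).ne
  have hres : Measurable fun s => (M s).restrict (A k) := by
    rw [Measure.measurable_measure]
    intro D hD
    simp_rw [Measure.restrict_apply hD]
    exact (Measure.measurable_coe (hD.inter (hmeas k))).comp hM
  exact (Measure.measurable_coe hB).comp (measurable_pi_of_isFiniteMeasure hres)

end PiMeasure

/-! ### Moment measures and the tilted partition sum -/

section Moment

variable {S V : Type*} [MeasurableSpace S] [MeasurableSpace V] {P : Measure S}
  {N : S → Measure V} {ρ : Measure V}

lemma ae_poissonLaw_lt_top {r : ℝ≥0∞} (hr : r ≠ ∞) : ∀ᵐ x ∂poissonLaw r, x < ∞ := by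
  rw [poissonLaw, if_neg hr, ae_map_iff (measurable_of_countable _).aemeasurable
    measurableSet_Iio]
  exact Filter.Eventually.of_forall fun k => ENNReal.natCast_lt_top k

lemma IsPoissonRandomMeasure.ae_lt_top (hN : IsPoissonRandomMeasure P N ρ) {B : Set V}
    (hB : MeasurableSet B) (h : ρ B ≠ ∞) : ∀ᵐ s ∂P, N s B < ∞ := by
  have := ae_poissonLaw_lt_top h
  rw [← hN.law B hB] at this
  exact ae_of_ae_map ((Measure.measurable_coe hB).comp hN.measurable).aemeasurable this

lemma IsPoissonRandomMeasure.ae_lt_top_spanningSets [SigmaFinite ρ]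
    (hN : IsPoissonRandomMeasure P N ρ) : ∀ᵐ s ∂P, ∀ k, N s (spanningSets ρ k) < ∞ :=
  ae_all_iff.2 fun k => hN.ae_lt_top (measurableSet_spanningSets ρ k)
    (measure_spanningSets_lt_top ρ k).ne

lemma IsPoissonRandomMeasure.ae_sigmaFinite [SigmaFinite ρ] (hN : IsPoissonRandomMeasure P N ρ) :
    ∀ᵐ s ∂P, SigmaFinite (N s) :=
  hN.ae_lt_top_spanningSets.mono fun _ hs => sigmaFinite_of_iUnion hs (iUnion_spanningSets ρ)

lemma IsPoissonRandomMeasure.aemeasurable_pi [SigmaFinite ρ] (hN : IsPoissonRandomMeasure P N ρ)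
    {ι : Type*} [Fintype ι] : AEMeasurable (fun s => Measure.pi (fun _ : ι => N s)) P := by
  classical
  -- `T` has full probability. Off `T` the measure `N s` need not be σ-finite, so it is replaced by
  -- `0` to obtain an everywhere measurable version.
  let T : Set S := {s | ∀ k, N s (spanningSets ρ k) < ∞}
  have hT : MeasurableSet T := by
    simp only [T, Set.ofPred_forall]
    exact MeasurableSet.iInter fun k => measurableSet_lt
      ((Measure.measurable_coe (measurableSet_spanningSets ρ k)).comp hN.measurable)
      measurable_const
  refine ⟨fun s => Measure.pi (fun _ : ι => T.piecewise N (fun _ => 0) s), ?_, ?_⟩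
  · refine measurable_pi_of_finite_on (hN.measurable.piecewise hT measurable_const)
      (monotone_spanningSets ρ) (measurableSet_spanningSets ρ) (iUnion_spanningSets ρ) ?_
    intro s k
    by_cases hs : s ∈ T
    · rw [Set.piecewise_eq_of_mem _ _ _ hs]
      exact hs k
    · simp [Set.piecewise_eq_of_notMem _ _ _ hs]
  · filter_upwards [hN.ae_lt_top_spanningSets] with s hs
    rw [Set.piecewise_eq_of_mem T _ _ hs]

lemma partitionSum_eq_cellSum {n : ℕ} (f : Fin n → V → ℝ≥0) (ρ : Measure V) :
    partitionSum f ρ =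
      cellSum Finset.univ (fun C => ∫⁻ v, ∏ i ∈ C, (f i v : ℝ≥0∞) ∂ρ) := rfl

/-- The moments of a Poisson random measure with σ-finite intensity, as a sum over partitions. -/
theorem IsPoissonRandomMeasure.lintegral_momentMeasure [IsProbabilityMeasure P] [SigmaFinite ρ]
    (hN : IsPoissonRandomMeasure P N ρ) {n : ℕ} {f : Fin n → V → ℝ≥0}
    (hf : ∀ i, Measurable (f i)) :
    ∫⁻ v : Fin n → V, ∏ i, (f i (v i) : ℝ≥0∞) ∂momentMeasure n P N = partitionSum f ρ := by
  have hf' : ∀ i, Measurable fun v => (f i v : ℝ≥0∞) := fun i => (hf i).coe_nnreal_ennreal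
  have hprod : Measurable fun v : Fin n → V => ∏ i, (f i (v i) : ℝ≥0∞) :=
    Finset.measurable_fun_prod _ fun i _ => (hf' i).comp (measurable_pi_apply i)
  rw [momentMeasure, Measure.lintegral_bind hN.aemeasurable_pi hprod.aemeasurable,
    partitionSum_eq_cellSum, ← hN.lintegral_prod hf']
  refine lintegral_congr_ae ?_
  filter_upwards [hN.ae_sigmaFinite] with s hs
  exact lintegral_pi_prod (N s) hf'

lemma sigmaFinite_tilted (ν : Measure V) [SigmaFinite ν] {g : V → ℝ≥0∞} :
    SigmaFinite (tilted ν g) :=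
  SigmaFinite.withDensity_of_ne_top (Filter.Eventually.of_forall fun _ => expNeg_ne_top _)

lemma partitionSum_tilted {n : ℕ} {f : Fin n → V → ℝ≥0} (hf : ∀ i, Measurable (f i))
    (ν : Measure V) {g : V → ℝ≥0∞} (hg : Measurable g) :
    partitionSum f (tilted ν g) =
      cellSum Finset.univ (fun C => ∫⁻ v, expNeg (g v) * ∏ i ∈ C, (f i v : ℝ≥0∞) ∂ν) := by
  rw [partitionSum_eq_cellSum]
  congr 1
  ext C
  rw [tilted, lintegral_withDensity_eq_lintegral_mul _ (by fun_prop)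
    (Finset.measurable_fun_prod _ fun i _ => (hf i).coe_nnreal_ennreal)]
  rfl

end Moment

end IntegratedVolatility

end

/-! ### The likelihood formula -/

theorem theorem3p1
    {V : Type*} [TopologicalSpace V] [PolishSpace V] [MeasurableSpace V] [BorelSpace V]
    (ν : Measure V) [SigmaFinite ν]
    {S : Type*} [MeasurableSpace S] (P : Measure S) [IsProbabilityMeasure P]
    (N : S → Measure V) (hN : IntegratedVolatility.IsPoissonRandomMeasure P N ν)
    (n : ℕ) (f : Fin n → V → ℝ≥0) (hf : ∀ i, Measurable (f i))
    (hΛ : ∀ w : Fin n → ℝ, (∀ i, 0 ≤ w i) →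
      IntegratedVolatility.laplaceExponent ν (IntegratedVolatility.weightedSum f w) < ∞)
    (X : Fin n → ℝ) (μ β Δ : ℝ) :
    -- the likelihood formula
    IntegratedVolatility.likelihood P
        (fun i => IntegratedVolatility.linearFunctional N (f i)) X μ β Δ =
      ∫⁻ w in IntegratedVolatility.posOrthant n,
        IntegratedVolatility.partitionSum f
            (IntegratedVolatility.tilted ν (IntegratedVolatility.weightedSum f w)) *
          IntegratedVolatility.expNeg
            (IntegratedVolatility.laplaceExponent ν (IntegratedVolatility.weightedSum f w)) *
          IntegratedVolatility.normalProduct X μ β Δ w ∧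
    -- the partition sum is finite, and it is the integral of `f₁(v₁) ⋯ fₙ(vₙ)` against the
    -- `n`-th moment measure of any Poisson random measure with the tilted intensity
    ∀ w ∈ IntegratedVolatility.posOrthant n,
      IntegratedVolatility.partitionSum f
          (IntegratedVolatility.tilted ν (IntegratedVolatility.weightedSum f w)) < ∞ ∧
      ∀ {S' : Type*} [MeasurableSpace S'] (P' : Measure S') [IsProbabilityMeasure P']
        (N' : S' → Measure V),
        IntegratedVolatility.IsPoissonRandomMeasure P' N'
          (IntegratedVolatility.tilted ν (IntegratedVolatility.weightedSum f w)) →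
        ∫⁻ v : Fin n → V, ∏ i, (f i (v i) : ℝ≥0∞) ∂(IntegratedVolatility.momentMeasure n P' N') =
          IntegratedVolatility.partitionSum f
            (IntegratedVolatility.tilted ν (IntegratedVolatility.weightedSum f w)) := by
  have hf' : ∀ i, Measurable fun v => (f i v : ℝ≥0∞) := fun i => (hf i).coe_nnreal_ennreal
  have hmeas : ∀ w : Fin n → ℝ, Measurable (IntegratedVolatility.weightedSum f w) := fun w => by
    unfold IntegratedVolatility.weightedSum
    fun_prop
  have hpos : ∀ w ∈ IntegratedVolatility.posOrthant n, ∀ i, ENNReal.ofReal (w i) ≠ 0 :=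
    fun w hw i => (ENNReal.ofReal_pos.2 (hw i)).ne'
  refine ⟨?_, fun w hw => ⟨?_, ?_⟩⟩
  · have hset : MeasurableSet (IntegratedVolatility.posOrthant n) := by
      simp only [IntegratedVolatility.posOrthant, Set.ofPred_forall]
      exact MeasurableSet.iInter fun i => measurableSet_lt measurable_const (measurable_pi_apply i)
    refine setLIntegral_congr_fun hset fun w hw => ?_
    have h := hN.lintegral_expNeg_mul_prod (hpos w hw) (fun _ => ENNReal.ofReal_ne_top) hf'
      (fun _ _ => ENNReal.coe_ne_top) (hΛ w fun i => (hw i).le)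
    simp only [IntegratedVolatility.linearFunctional]
    rw [h, IntegratedVolatility.partitionSum_tilted hf ν (hmeas w), mul_comm,
      mul_comm (IntegratedVolatility.expNeg _)]
    rfl
  · rw [IntegratedVolatility.partitionSum_tilted hf ν (hmeas w)]
    refine ENNReal.sum_lt_top.2 fun p _ => ENNReal.prod_lt_top fun C hC => ?_
    exact IntegratedVolatility.lintegral_expNeg_mul_prod_lt_top (hpos w hw)
      (fun _ => ENNReal.ofReal_ne_top) hf' (hΛ w fun i => (hw i).le) (p.nonempty_of_mem_parts hC)
  · intro S' _ P' _ N' hN'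
    have := IntegratedVolatility.sigmaFinite_tilted ν
      (g := IntegratedVolatility.weightedSum f w)
    exact hN'.lintegral_momentMeasure hf
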